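/- Notation. For a vector $x\in\mathbb C^d$ and an integer $s\ge 1$, $x_s$ denotes a vector obtained from $x$ by keeping $s$ components that are largest in magnitude and setting the others to zero (ties broken arbitrarily; $x_s=x$ if $s\ge d$). For $A\in\mathbb C^{m\times d}$, $A_T$ is the submatrix of the columns indexed by $T$, and $\|A\|_2^{(s)}$ is the largest spectral norm of an $s$-column submatrix of $A$ (it is $\|A\|_2$ if $s>d$). The restricted isometry constant $\delta_s$ of $A$ is the least $\delta\ge 0$ such that $(1-\delta)\|z\|_2^2\le\|Az\|_2^2\le(1+\delta)\|z\|_2^2$ for all $z$ with at most $s$ nonzero components. For $A,\Phi\in\mathbb C^{m\times d}$ put $$\varepsilon_A^{(s)}=\frac{\|A-\Phi\|_2^{(s)}}{\|A\|_2^{(s)}},\quad \kappa_A^{(s)}=\frac{\sqrt{1+\delta_s}}{\sqrt{1-\delta_s}},\quad \alpha_s=\frac{\|x-x_s\|_2}{\|x_s\|_2},\quad \beta_s=\frac{\|x-x_s\|_1}{\sqrt s\,\|x_s\|_2}$$ (with $\delta_s$ the constant of $A$, and with $\alpha_s=\beta_s=0$ if $x=0$). CoSaMP with matrix $\Phi$,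 samples $y$ and sparsity level $s$ starts from $a^0=0$ and computes $a^{k+1}$ from $a^k$ as follows: $v=y-\Phi a^k$; $u=\Phi^*v$; $T=\operatorname{supp}(u_{2s})\cup\operatorname{supp}(a^k)$; $w|_T=\Phi_T^\dagger y$ and $w|_{T^c}=0$, where $\dagger$ is the Moore–Penrose pseudoinverse; $a^{k+1}=w_s$. Theorem. There are an absolute constant $C>0$ and a function $N:\mathbb N\to\mathbb N$ such that the following holds for all $m,d\ge 0$, $s\ge 1$, all $A,\Phi\in\mathbb C^{m\times d}$, $x\in\mathbb C^d$, $e\in\mathbb C^m$. Suppose that $$\delta_{4s}\le\frac{1.1}{\bigl(1+\varepsilon_A^{(4s)}\bigr)^2}-1\qquad\text{and}\qquad \alpha_s+\beta_s\le\frac{1}{2\kappa_A^{(s)}} ,$$ where $\delta_{4s}$ is the restricted isometry constant of $A$. Let $b=Ax$ and $y=b+e$, and let $x^\sharp=a^k$ be the output of CoSaMP with decoding matrix $\Phi$ (instead of $A$), samples $y$ and sparsity level $s$, halted after any number $k\ge N(s)$ of iterations. Then $$\|x^\sharp-x\|_2\le C\Bigl(\|x-x_s\|_2+\tfrac1{\sqrt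 s}\|x-x_s\|_1+\bigl(\|A-\Phi\|_2\,\alpha_s+\|A-\Phi\|_2^{(s)}\bigr)\|b\|_2+\|e\|_2\Bigr).$$ -/

import Mathlib

open scoped Matrix

namespace MixedCoSaMP

noncomputable section

open Classical in
/-- The support of a vector. -/
def supp {d : ℕ} (x : EuclideanSpace ℂ (Fin d)) : Finset (Fin d) :=
  Finset.univ.filter fun i => x i ≠ 0

/-- The `ℓ₁` norm. -/
def l1Norm {d : ℕ} (x : EuclideanSpace ℂ (Fin d)) : ℝ := ∑ i, ‖x i‖

/-- `A` satisfies the restricted isometry property with parameters `(s, δ)`. -/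
def RIP {m d : ℕ} (A : Matrix (Fin m) (Fin d) ℂ) (s : ℕ) (δ : ℝ) : Prop :=
  ∀ x : EuclideanSpace ℂ (Fin d), (supp x).card ≤ s →
    (1 - δ) * ‖x‖ ^ 2 ≤ ‖Matrix.toEuclideanLin A x‖ ^ 2 ∧
      ‖Matrix.toEuclideanLin A x‖ ^ 2 ≤ (1 + δ) * ‖x‖ ^ 2

/-- The restricted isometry constant `δ_s` of `A`: the least `δ ≥ 0` for which `A` satisfies the
restricted isometry property with parameters `(s, δ)`. The set below is closed and non-empty, so
the infimum is attained. -/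
def ric {m d : ℕ} (A : Matrix (Fin m) (Fin d) ℂ) (s : ℕ) : ℝ :=
  sInf {δ : ℝ | 0 ≤ δ ∧ RIP A s δ}

/-- The submatrix `A_T` of the columns of `A` indexed by `T`. -/
def cols {m d : ℕ} (A : Matrix (Fin m) (Fin d) ℂ) (T : Finset (Fin d)) :
    Matrix (Fin m) {i // i ∈ T} ℂ :=
  A.submatrix id fun i => i.1

open scoped Matrix.Norms.L2Operator in
/-- The spectral norm `‖A‖₂` of a matrix. -/
def specNorm {m n : Type*} [Fintype m] [Fintype n] [DecidableEq n] (A : Matrix m n ℂ) : ℝ := ‖A‖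

/-- `‖A‖₂^{(s)}`, the largest spectral norm over all `s`-column submatrices of `A`. The spectral
norm does not decrease when columns are added, so allowing fewer columns changes nothing when
`s ≤ d`; when `s > d` the value is `‖A‖₂`. -/
def specNormCols {m d : ℕ} (A : Matrix (Fin m) (Fin d) ℂ) (s : ℕ) : ℝ :=
  ⨆ T : {T : Finset (Fin d) // T.card ≤ s}, specNorm (cols A T.1)

/-- The relative perturbation `ε_A^{(s)} = ‖A - Φ‖₂^{(s)} / ‖A‖₂^{(s)}`. -/
def relPert {m d : ℕ} (A Φ : Matrix (Fin m) (Fin d) ℂ) (s : ℕ) : ℝ :=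
  specNormCols (A - Φ) s / specNormCols A s

/-- `κ_A^{(s)} = √(1 + δ_s) / √(1 - δ_s)`. -/
def kappa {m d : ℕ} (A : Matrix (Fin m) (Fin d) ℂ) (s : ℕ) : ℝ :=
  √(1 + ric A s) / √(1 - ric A s)

/-- `xs` is obtained from `x` by keeping `s` components that are largest in magnitude and setting
the others to zero (ties are broken arbitrarily; if `s ≥ d` everything is kept). -/
def IsLargestPart {d : ℕ} (s : ℕ) (x xs : EuclideanSpace ℂ (Fin d)) : Prop :=
  ∃ S : Finset (Fin d), S.card = min s d ∧ (∀ i ∈ S, ∀ j ∉ S, ‖x j‖ ≤ ‖x i‖) ∧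
    (∀ i ∈ S, xs i = x i) ∧ ∀ i ∉ S, xs i = 0

/-- `α_s = ‖x - x_s‖₂ / ‖x_s‖₂`, as a function of `x` and `x_s`. -/
def alpha {d : ℕ} (x xs : EuclideanSpace ℂ (Fin d)) : ℝ := ‖x - xs‖ / ‖xs‖

/-- `β_s = ‖x - x_s‖₁ / (√s ‖x_s‖₂)`, as a function of `s`, `x` and `x_s`. -/
def beta {d : ℕ} (s : ℕ) (x xs : EuclideanSpace ℂ (Fin d)) : ℝ :=
  l1Norm (x - xs) / (√(s : ℝ) * ‖xs‖)

/-- `B` is the Moore–Penrose pseudoinverse of `M` (the four Penrose equations). -/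
structure IsPinv {m n : Type*} [Fintype m] [Fintype n] (M : Matrix m n ℂ) (B : Matrix n m ℂ) :
    Prop where
  mul_mul_self : M * B * M = M
  mul_mul_inv : B * M * B = B
  left_herm : (M * B)ᴴ = M * B
  right_herm : (B * M)ᴴ = B * M

open scoped ComplexOrder in
theorem exists_isPinv {m n : Type*} [Fintype m] [Fintype n] [DecidableEq n] (M : Matrix m n ℂ) :
    ∃ B : Matrix n m ℂ, IsPinv M B := by
  have hH : (Mᴴ * M).IsHermitian := Matrix.isHermitian_conjTranspose_mul_self M
  -- a Hermitian generalized inverse of `Mᴴ * M` that commutes with it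
  obtain ⟨G, hG, hc, h1, h2⟩ : ∃ G : Matrix n n ℂ, Gᴴ = G ∧ (Mᴴ * M) * G = G * (Mᴴ * M) ∧
      (Mᴴ * M) * G * (Mᴴ * M) = Mᴴ * M ∧ G * (Mᴴ * M) * G = G := by
    set U : Matrix n n ℂ := (hH.eigenvectorUnitary : Matrix n n ℂ) with hU
    have hUU : Uᴴ * U = 1 := by
      simpa [Matrix.star_eq_conjTranspose] using
        Unitary.coe_star_mul_self hH.eigenvectorUnitary
    set D : n → ℂ := fun i => (hH.eigenvalues i : ℂ) with hD
    have hspec : Mᴴ * M = U * Matrix.diagonal D * Uᴴ := by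
      have := hH.spectral_theorem
      rw [Unitary.conjStarAlgAut_apply] at this
      exact this
    have key : ∀ X Y : Matrix n n ℂ, (U * X * Uᴴ) * (U * Y * Uᴴ) = U * (X * Y) * Uᴴ := by
      intro X Y
      calc (U * X * Uᴴ) * (U * Y * Uᴴ) = U * X * (Uᴴ * U) * Y * Uᴴ := by
            simp only [Matrix.mul_assoc]
        _ = _ := by rw [hUU]; simp only [Matrix.mul_assoc, Matrix.one_mul]
    refine ⟨U * Matrix.diagonal (fun i => (D i)⁻¹) * Uᴴ, ?_, ?_, ?_, ?_⟩
    · simp only [Matrix.conjTranspose_mul, Matrix.conjTranspose_conjTranspose,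
        Matrix.diagonal_conjTranspose, Matrix.mul_assoc]
      congr 3
      ext i
      simp [hD]
    · rw [hspec, key, key]
      simp [Matrix.diagonal_mul_diagonal, mul_comm]
    · rw [hspec, key, key]
      simp [Matrix.diagonal_mul_diagonal]
    · rw [hspec, key, key]
      congr 2
      simp only [Matrix.diagonal_mul_diagonal]
      congr 1
      ext i
      by_cases h : D i = 0 <;> simp [h]
  have h3 : M * (G * (Mᴴ * M)) = M := by
    have h0 : Mᴴ * M * (G * (Mᴴ * M) - 1) = 0 := by
      rw [Matrix.mul_sub, ← Matrix.mul_assoc, h1, Matrix.mul_one, sub_self]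
    have := (Matrix.conjTranspose_mul_self_mul_eq_zero M _).1 h0
    rw [Matrix.mul_sub, Matrix.mul_one, sub_eq_zero] at this
    exact this
  refine ⟨G * Mᴴ, ?_, ?_, ?_, ?_⟩
  · simpa only [Matrix.mul_assoc] using h3
  · have := congrArg (· * Mᴴ) h2
    simpa only [Matrix.mul_assoc] using this
  · simp only [Matrix.conjTranspose_mul, Matrix.conjTranspose_conjTranspose, hG, Matrix.mul_assoc]
  · rw [Matrix.mul_assoc, Matrix.conjTranspose_mul, hG, hH.eq, hc]

/-- The Moore–Penrose pseudoinverse `M†`. -/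
def pinv {m n : Type*} [Fintype m] [Fintype n] [DecidableEq n] (M : Matrix m n ℂ) :
    Matrix n m ℂ :=
  (exists_isPinv M).choose

theorem isPinv_pinv {m n : Type*} [Fintype m] [Fintype n] [DecidableEq n] (M : Matrix m n ℂ) :
    IsPinv M (pinv M) :=
  (exists_isPinv M).choose_spec

/-- `w|_T = Φ_T† y` and `w|_{Tᶜ} = 0`. -/
def IsEstimate {m d : ℕ} (Φ : Matrix (Fin m) (Fin d) ℂ) (y : EuclideanSpace ℂ (Fin m))
    (T : Finset (Fin d)) (w : EuclideanSpace ℂ (Fin d)) : Prop :=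
  (∀ i : {i // i ∈ T}, w i.1 = (pinv (cols Φ T) *ᵥ y.ofLp) i) ∧ ∀ i ∉ T, w i = 0

/-- One iteration of CoSaMP with matrix `Φ`, samples `y` and sparsity level `s` can lead from the
approximation `a` to the approximation `a'`. -/
def IsStep {m d : ℕ} (Φ : Matrix (Fin m) (Fin d) ℂ) (y : EuclideanSpace ℂ (Fin m)) (s : ℕ)
    (a a' : EuclideanSpace ℂ (Fin d)) : Prop :=
  ∃ v : EuclideanSpace ℂ (Fin m), ∃ u u' w : EuclideanSpace ℂ (Fin d),
    v = y - Matrix.toEuclideanLin Φ a ∧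
    u = Matrix.toEuclideanLin Φᴴ v ∧
    IsLargestPart (2 * s) u u' ∧
    IsEstimate Φ y (supp u' ∪ supp a) w ∧
    IsLargestPart s w a'

/-- `a 0, a 1, a 2, …` are the successive approximations of a run of CoSaMP with matrix `Φ`,
samples `y` and sparsity level `s`. -/
def IsRun {m d : ℕ} (Φ : Matrix (Fin m) (Fin d) ℂ) (y : EuclideanSpace ℂ (Fin m)) (s : ℕ)
    (a : ℕ → EuclideanSpace ℂ (Fin d)) : Prop :=
  a 0 = 0 ∧ ∀ k, IsStep Φ y s (a k) (a (k + 1))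

end

end MixedCoSaMP
/-!
For `r` of support size at most `2 s` the proxy `Φ*(Φ r + e)` differs from `r`, on every set of at
most `2 s` further coordinates, by at most `δ ‖r‖ + √(1 + δ) ‖e‖`. This one estimate shows both that
the `2 s` largest entries of the proxy miss little of the current error `x - a` and that the
least-squares estimate is nearly as good as the coordinates it works on, so that an iteration
contracts, up to the noise, the part of `x` missed by the merged support. That part takes at most
`2 ^ s` values, which bounds the number of iterations in terms of `s` alone.

The perturbation enters twice. `Φ` inherits a restricted isometry constant
`(1 + ε)² (1 + δ) - 1 ≤ 1/10` from `A`. And, as a decoder of the samples of a vector `z` with at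
most `s` nonzero components, it sees the effective noise
`A x + e - Φ z = A (x - z) + (A - Φ) z + e`.
-/

namespace MixedCoSaMP

open Matrix (toEuclideanLin)

section Auxiliary

theorem le_of_forall_succ_lt_of_card_le {α : Type*} [LinearOrder α] {u : ℕ → α} {c : α}
    (hle : ∀ k, u k ≤ c → u (k + 1) ≤ c) (hlt : ∀ k, c < u k → u (k + 1) < u k)
    {F : Finset α} (hF : ∀ k, u k ∈ F) {k : ℕ} (hk : F.card ≤ k) : u k ≤ c := by
  by_contra! hc
  have above : ∀ j ≤ k, c < u j := fun j hj => by
    by_contra! hj'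
    exact hc.not_ge (Nat.le_induction hj' (fun i _ => hle i) k hj)
  have hanti : StrictAntiOn u (Set.Iic k) :=
    strictAntiOn_Iic_of_succ_lt fun j hj => hlt j (above j hj.le)
  have hcard : (Finset.Iic k).card ≤ F.card :=
    Finset.card_le_card_of_injOn u (fun j _ => hF j) (by simpa using hanti.injOn)
  rw [Nat.card_Iic] at hcard
  omega

theorem sum_le_sum_of_forall_notMem_le {ι M : Type*} [AddCommMonoid M] [LinearOrder M]
    [IsOrderedCancelAddMonoid M] {f : ι → M} (hf : ∀ i, 0 ≤ f i) {R S : Finset ι}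
    (hcard : R.card ≤ S.card) (hS : ∀ i ∈ S, ∀ j ∉ S, f j ≤ f i) :
    ∑ i ∈ R, f i ≤ ∑ i ∈ S, f i := by
  classical
  rw [← Finset.sum_sdiff_le_sum_sdiff]
  rcases (R \ S).eq_empty_or_nonempty with h | h
  · rw [h, Finset.sum_empty]
    exact Finset.sum_nonneg fun i _ => hf i
  · obtain ⟨j, hj, hmax⟩ := Finset.exists_max_image _ f h
    calc ∑ i ∈ R \ S, f i ≤ (R \ S).card • f j := Finset.sum_le_card_nsmul _ _ _ hmax
      _ ≤ (S \ R).card • f j :=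
        nsmul_le_nsmul_left (hf j) (Finset.card_sdiff_le_card_sdiff_iff.2 hcard)
      _ ≤ ∑ i ∈ S \ R, f i := Finset.card_nsmul_le_sum _ _ _ fun i hi =>
        hS i (Finset.mem_sdiff.1 hi).1 j (Finset.mem_sdiff.1 hj).2

end Auxiliary

section Restriction

variable {ι 𝕜 : Type*} [DecidableEq ι] [RCLike 𝕜]

/-- The restriction `x|_T` of a vector to a set `T` of coordinates, extended by zero. -/
noncomputable def restr (T : Finset ι) : EuclideanSpace 𝕜 ι →ₗ[𝕜] EuclideanSpace 𝕜 ι where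
  toFun x := WithLp.toLp 2 fun i => if i ∈ T then x i else 0
  map_add' x y := by ext i; by_cases h : i ∈ T <;> simp [h]
  map_smul' c x := by ext i; by_cases h : i ∈ T <;> simp [h]

theorem restr_apply (T : Finset ι) (x : EuclideanSpace 𝕜 ι) (i : ι) :
    restr T x i = if i ∈ T then x i else 0 := rfl

theorem restr_congr {T : Finset ι} {x y : EuclideanSpace 𝕜 ι} (h : ∀ i ∈ T, x i = y i) :
    restr T x = restr T y := by
  ext i
  by_cases hi : i ∈ T <;> simp [restr_apply, hi, h]

theorem restr_add_restr_compl [Fintype ι] (T : Finset ι) (x : EuclideanSpace 𝕜 ι) :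
    restr T x + restr Tᶜ x = x := by
  ext i
  by_cases hi : i ∈ T <;> simp [restr_apply, hi]

variable [Fintype ι]

theorem norm_sq_restr (T : Finset ι) (x : EuclideanSpace 𝕜 ι) :
    ‖restr T x‖ ^ 2 = ∑ i ∈ T, ‖x i‖ ^ 2 := by
  simp [EuclideanSpace.norm_sq_eq, restr_apply, apply_ite]

theorem norm_restr_le_norm_restr_iff {T T' : Finset ι} {x y : EuclideanSpace 𝕜 ι} :
    ‖restr T x‖ ≤ ‖restr T' y‖ ↔ ∑ i ∈ T, ‖x i‖ ^ 2 ≤ ∑ i ∈ T', ‖y i‖ ^ 2 := by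
  rw [← sq_le_sq₀ (norm_nonneg _) (norm_nonneg _), norm_sq_restr, norm_sq_restr]

theorem norm_restr_mono {T T' : Finset ι} (h : T ⊆ T') (x : EuclideanSpace 𝕜 ι) :
    ‖restr T x‖ ≤ ‖restr T' x‖ :=
  norm_restr_le_norm_restr_iff.2
    (Finset.sum_le_sum_of_subset_of_nonneg h fun _ _ _ => sq_nonneg _)

theorem norm_restr_le (T : Finset ι) (x : EuclideanSpace 𝕜 ι) : ‖restr T x‖ ≤ ‖x‖ := by
  refine (norm_restr_mono T.subset_univ x).trans_eq (congrArg norm ?_)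
  ext i
  simp [restr_apply]

theorem norm_sq_restr_eq_re_inner (T : Finset ι) (x : EuclideanSpace 𝕜 ι) :
    ‖restr T x‖ ^ 2 = RCLike.re (inner 𝕜 (restr T x) x) := by
  rw [← inner_self_eq_norm_sq (𝕜 := 𝕜)]
  congr 1
  simp only [PiLp.inner_apply]
  exact Finset.sum_congr rfl fun i _ => by by_cases h : i ∈ T <;> simp [restr_apply, h]

end Restriction

section Support

variable {d : ℕ} {T : Finset (Fin d)} {x y : EuclideanSpace ℂ (Fin d)}

theorem mem_supp {i : Fin d} : i ∈ supp x ↔ x i ≠ 0 := by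
  simp [supp]

theorem notMem_supp {i : Fin d} : i ∉ supp x ↔ x i = 0 := by
  simp [supp]

theorem supp_subset_iff : supp x ⊆ T ↔ ∀ i ∉ T, x i = 0 :=
  ⟨fun h _ hi => notMem_supp.1 fun hx => hi (h hx), fun h i hi => by
    by_contra hT
    exact mem_supp.1 hi (h i hT)⟩

theorem supp_add_subset (x y : EuclideanSpace ℂ (Fin d)) : supp (x + y) ⊆ supp x ∪ supp y :=
  supp_subset_iff.2 fun i hi => by
    simp only [Finset.mem_union, not_or, notMem_supp] at hi
    simp [hi]

theorem supp_neg (x : EuclideanSpace ℂ (Fin d)) : supp (-x) = supp x := by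
  ext i
  simp [mem_supp]

theorem supp_sub_subset (x y : EuclideanSpace ℂ (Fin d)) : supp (x - y) ⊆ supp x ∪ supp y := by
  simpa only [sub_eq_add_neg, supp_neg] using supp_add_subset x (-y)

theorem supp_smul_subset (c : ℂ) (x : EuclideanSpace ℂ (Fin d)) : supp (c • x) ⊆ supp x :=
  supp_subset_iff.2 fun i hi => by simp [notMem_supp.1 hi]

theorem supp_restr_subset (T : Finset (Fin d)) (x : EuclideanSpace ℂ (Fin d)) :
    supp (restr T x) ⊆ T :=
  supp_subset_iff.2 fun _ hi => if_neg hi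

theorem restr_compl_eq_restr_supp_sdiff (T : Finset (Fin d)) (x : EuclideanSpace ℂ (Fin d)) :
    restr Tᶜ x = restr (supp x \ T) x := by
  ext i
  by_cases hi : i ∈ supp x
  · simp [restr_apply, hi]
  · simp [restr_apply, notMem_supp.1 hi]

theorem card_supp_sub_le (x y : EuclideanSpace ℂ (Fin d)) :
    (supp (x - y)).card ≤ (supp x).card + (supp y).card :=
  (Finset.card_le_card (supp_sub_subset x y)).trans (Finset.card_union_le _ _)

theorem l1Norm_nonneg (x : EuclideanSpace ℂ (Fin d)) : 0 ≤ l1Norm x :=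
  Finset.sum_nonneg fun _ _ => norm_nonneg _

end Support

section LargestPart

variable {d s : ℕ} {x xs : EuclideanSpace ℂ (Fin d)}

theorem exists_isLargestPart (s : ℕ) (x : EuclideanSpace ℂ (Fin d)) :
    ∃ xs, IsLargestPart s x xs := by
  set σ := Tuple.sort fun i => -‖x i‖
  have hσ : Monotone fun i => -‖x (σ i)‖ := Tuple.monotone_sort fun i => -‖x i‖
  set S : Finset (Fin d) := ({i | (i : ℕ) < s} : Finset (Fin d)).map σ.toEmbedding with hS
  refine ⟨restr S x, S, ?_, fun i hi j hj => ?_, fun i hi => if_pos hi, fun i hi => if_neg hi⟩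
  · rw [Finset.card_map, Fin.card_filter_val_lt, min_comm]
  · simp only [hS, Finset.mem_map_equiv, Finset.mem_filter_univ, not_lt] at hi hj
    have := hσ (Fin.le_def.2 (hi.le.trans hj))
    simpa using this

theorem IsLargestPart.card_supp_le (h : IsLargestPart s x xs) : (supp xs).card ≤ s := by
  obtain ⟨S, hS, -, -, h0⟩ := h
  exact (Finset.card_le_card (supp_subset_iff.2 h0)).trans (hS.le.trans (min_le_left _ _))

theorem IsLargestPart.eq_restr (h : IsLargestPart s x xs) : xs = restr (supp xs) x := by
  obtain ⟨S, -, -, h1, h0⟩ := h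
  ext i
  by_cases hi : i ∈ supp xs
  · rw [restr_apply, if_pos hi, h1 i (supp_subset_iff.2 h0 hi)]
  · rw [restr_apply, if_neg hi, notMem_supp.1 hi]

theorem IsLargestPart.sub_eq_restr (h : IsLargestPart s x xs) : x - xs = restr (supp xs)ᶜ x := by
  conv_lhs => rw [h.eq_restr]
  rw [sub_eq_iff_eq_add', restr_add_restr_compl]

theorem IsLargestPart.sum_norm_sq_le (h : IsLargestPart s x xs) {R : Finset (Fin d)}
    (hR : R.card ≤ s) : ∑ i ∈ R, ‖x i‖ ^ 2 ≤ ∑ i ∈ supp xs, ‖x i‖ ^ 2 := by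
  have heq := h.eq_restr
  obtain ⟨S, hS, hdom, h1, h0⟩ := h
  have hxs : xs = restr S x := by
    ext i
    by_cases hi : i ∈ S <;> simp [restr_apply, hi, h1, h0]
  rw [← norm_sq_restr (supp xs), ← heq, hxs, norm_sq_restr]
  refine sum_le_sum_of_forall_notMem_le (fun _ => sq_nonneg _) ?_ fun i hi j hj => ?_
  · rw [hS]
    exact le_min hR (by simpa using R.card_le_univ)
  · exact pow_le_pow_left₀ (norm_nonneg _) (hdom i hi j hj) 2

theorem IsLargestPart.norm_restr_sdiff_le (h : IsLargestPart s x xs) {R : Finset (Fin d)}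
    (hR : R.card ≤ s) : ‖restr (R \ supp xs) x‖ ≤ ‖restr (supp xs \ R) x‖ :=
  norm_restr_le_norm_restr_iff.2 (Finset.sum_sdiff_le_sum_sdiff.2 (h.sum_norm_sq_le hR))

theorem IsLargestPart.norm_sub_le (h : IsLargestPart s x xs) {z : EuclideanSpace ℂ (Fin d)}
    (hz : (supp z).card ≤ s) : ‖x - xs‖ ≤ ‖x - z‖ :=
  calc ‖x - xs‖ = ‖restr (supp xs)ᶜ x‖ := by rw [h.sub_eq_restr]
    _ ≤ ‖restr (supp z)ᶜ x‖ := norm_restr_le_norm_restr_iff.2 <| by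
      have := h.sum_norm_sq_le hz
      have h1 := Finset.sum_add_sum_compl (supp xs) fun i => ‖x i‖ ^ 2
      have h2 := Finset.sum_add_sum_compl (supp z) fun i => ‖x i‖ ^ 2
      linarith
    _ = ‖restr (supp z)ᶜ (x - z)‖ := by
      congr 1
      refine restr_congr fun i hi => ?_
      simp [notMem_supp.1 (Finset.mem_compl.1 hi)]
    _ ≤ ‖x - z‖ := norm_restr_le _ _

theorem IsLargestPart.l1Norm_add_l1Norm_sub (h : IsLargestPart s x xs) :
    l1Norm xs + l1Norm (x - xs) = l1Norm x := by
  obtain ⟨S, -, -, h1, h0⟩ := h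
  rw [l1Norm, l1Norm, ← Finset.sum_add_distrib]
  refine Finset.sum_congr rfl fun i _ => ?_
  by_cases hi : i ∈ S
  · simp [h1 i hi]
  · simp [h0 i hi]

theorem IsLargestPart.mul_norm_sub_apply_le (h : IsLargestPart s x xs) (i : Fin d) :
    s * ‖(x - xs) i‖ ≤ l1Norm xs := by
  obtain ⟨S, hS, hdom, h1, h0⟩ := h
  by_cases hi : i ∈ S
  · simpa [h1 i hi] using l1Norm_nonneg xs
  have hSs : S.card = s := by
    have := Finset.card_lt_univ_of_notMem hi
    rw [Fintype.card_fin] at this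
    omega
  calc s * ‖(x - xs) i‖ = S.card • ‖x i‖ := by simp [h0 i hi, hSs]
    _ ≤ ∑ j ∈ S, ‖x j‖ := Finset.card_nsmul_le_sum _ _ _ fun j hj => hdom j hj i hi
    _ = ∑ j ∈ S, ‖xs j‖ := Finset.sum_congr rfl fun j hj => by rw [h1 j hj]
    _ ≤ l1Norm xs :=
      Finset.sum_le_sum_of_subset_of_nonneg S.subset_univ fun _ _ _ => norm_nonneg _

theorem IsLargestPart.card_supp_sub_lt (h : IsLargestPart s x xs) (hs : 1 ≤ s) (hx : x ≠ 0) :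
    (supp (x - xs)).card < (supp x).card := by
  have hxs : xs ≠ 0 := by
    rintro rfl
    refine hx (PiLp.ext fun i => ?_)
    have hi : (s : ℝ) * ‖x i‖ ≤ 0 := by simpa [l1Norm] using h.mul_norm_sub_apply_le i
    have hs0 : (0 : ℝ) < s := by exact_mod_cast hs
    exact norm_le_zero_iff.1 (nonpos_of_mul_nonpos_right hi hs0)
  obtain ⟨i, hi⟩ : ∃ i, xs i ≠ 0 := by
    by_contra! h0
    exact hxs (PiLp.ext h0)
  obtain ⟨S, -, -, h1, h0⟩ := h
  have hiS : i ∈ S := by_contra fun hiS => hi (h0 i hiS)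
  refine Finset.card_lt_card ((Finset.ssubset_iff_of_subset ?_).2 ⟨i, ?_, ?_⟩)
  · refine supp_subset_iff.2 fun j hj => ?_
    by_cases hjS : j ∈ S
    · simp [h1 j hjS]
    · simp [h0 j hjS, notMem_supp.1 hj]
  · rwa [mem_supp, ← h1 i hiS]
  · simp [notMem_supp, h1 i hiS]

end LargestPart

section SpectralNorm

variable {m d s : ℕ} {A : Matrix (Fin m) (Fin d) ℂ} {T : Finset (Fin d)}
  {x : EuclideanSpace ℂ (Fin d)}

theorem mulVec_eq_cols_mulVec (A : Matrix (Fin m) (Fin d) ℂ) {x : Fin d → ℂ}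
    (hx : ∀ i ∉ T, x i = 0) : A *ᵥ x = cols A T *ᵥ fun i => x i.1 := by
  ext j
  simp only [Matrix.mulVec, dotProduct, cols, Matrix.submatrix_apply, id]
  rw [← Finset.sum_subset (Finset.subset_univ T) fun i _ hi => by rw [hx i hi, mul_zero],
    ← Finset.sum_coe_sort]

theorem norm_toLp_coe_eq (hx : ∀ i ∉ T, x i = 0) :
    ‖WithLp.toLp 2 fun i : {i // i ∈ T} => x i.1‖ = ‖x‖ := by
  rw [EuclideanSpace.norm_eq, EuclideanSpace.norm_eq,
    ← Finset.sum_subset (Finset.subset_univ T) fun i _ hi => by simp [hx i hi],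
    ← Finset.sum_coe_sort T]

open scoped Matrix.Norms.L2Operator in
theorem specNorm_nonneg {m n : Type*} [Fintype m] [Fintype n] [DecidableEq n]
    (A : Matrix m n ℂ) : 0 ≤ specNorm A :=
  norm_nonneg A

theorem specNormCols_nonneg (A : Matrix (Fin m) (Fin d) ℂ) (s : ℕ) : 0 ≤ specNormCols A s :=
  Real.iSup_nonneg fun _ => specNorm_nonneg _

open scoped Matrix.Norms.L2Operator in
theorem norm_le_specNormCols (A : Matrix (Fin m) (Fin d) ℂ) (hx : (supp x).card ≤ s) :
    ‖toEuclideanLin A x‖ ≤ specNormCols A s * ‖x‖ := by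
  have h0 : ∀ i ∉ supp x, x i = 0 := supp_subset_iff.1 subset_rfl
  have hcols := Matrix.l2_opNorm_mulVec (cols A (supp x)) (WithLp.toLp 2 fun i => x i.1)
  rw [← mulVec_eq_cols_mulVec A h0, norm_toLp_coe_eq h0] at hcols
  have hsup : specNorm (cols A (supp x)) ≤ specNormCols A s :=
    le_ciSup (f := fun T : {T : Finset (Fin d) // T.card ≤ s} => specNorm (cols A T.1))
      (Set.finite_range _).bddAbove ⟨supp x, hx⟩
  exact hcols.trans (mul_le_mul_of_nonneg_right hsup (norm_nonneg x))

theorem specNormCols_le {c : ℝ} (hc : 0 ≤ c)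
    (h : ∀ x : EuclideanSpace ℂ (Fin d), (supp x).card ≤ s → ‖toEuclideanLin A x‖ ≤ c * ‖x‖) :
    specNormCols A s ≤ c := by
  refine Real.iSup_le (fun T => ?_) hc
  rw [specNorm, Matrix.l2_opNorm_def]
  refine ContinuousLinearMap.opNorm_le_bound _ hc fun g => ?_
  set x : EuclideanSpace ℂ (Fin d) :=
    WithLp.toLp 2 fun i => if hi : i ∈ T.1 then g ⟨i, hi⟩ else 0 with hxdef
  have h0 : ∀ i ∉ T.1, x i = 0 := fun i hi => by simp [hxdef, hi]
  have hg : g = WithLp.toLp 2 fun i : {i // i ∈ T.1} => x i.1 := by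
    ext i
    simp [hxdef]
  have hx := h x ((Finset.card_le_card (supp_subset_iff.2 h0)).trans T.2)
  rw [← norm_toLp_coe_eq h0, ← hg] at hx
  refine le_trans (le_of_eq (congrArg norm ?_)) hx
  rw [hg]
  exact congrArg (WithLp.toLp 2) (mulVec_eq_cols_mulVec A h0).symm

theorem specNormCols_mono (A : Matrix (Fin m) (Fin d) ℂ) {t : ℕ} (hst : s ≤ t) :
    specNormCols A s ≤ specNormCols A t :=
  specNormCols_le (specNormCols_nonneg A t) fun _ hx => norm_le_specNormCols A (hx.trans hst)

theorem norm_le_sqrt_mul {M : ℝ} (hM : 0 ≤ M) (hx : (supp x).card ≤ s) (h : ∀ i, ‖x i‖ ≤ M) :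
    ‖x‖ ≤ √s * M := by
  refine le_of_sq_le_sq ?_ (by positivity)
  calc ‖x‖ ^ 2 = ∑ i ∈ supp x, ‖x i‖ ^ 2 := by
        rw [EuclideanSpace.norm_sq_eq]
        exact (Finset.sum_subset (Finset.subset_univ _) fun i _ hi => by
          simp [notMem_supp.1 hi]).symm
    _ ≤ (supp x).card • M ^ 2 :=
      Finset.sum_le_card_nsmul _ _ _ fun i _ => pow_le_pow_left₀ (norm_nonneg _) (h i) 2
    _ ≤ s • M ^ 2 := nsmul_le_nsmul_left (sq_nonneg M) hx
    _ = (√s * M) ^ 2 := by rw [mul_pow, Real.sq_sqrt s.cast_nonneg, nsmul_eq_mul]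

theorem IsLargestPart.norm_isLargestPart_sub_le {xs ys : EuclideanSpace ℂ (Fin d)}
    (hs : 1 ≤ s) (hx : IsLargestPart s x xs) (hy : IsLargestPart s (x - xs) ys) :
    ‖ys‖ ≤ l1Norm xs / √s := by
  have hs0 : (0 : ℝ) < s := by exact_mod_cast hs
  have hentry (i : Fin d) : ‖ys i‖ ≤ l1Norm xs / s := by
    rw [le_div_iff₀' hs0, hy.eq_restr, restr_apply]
    split_ifs
    · exact hx.mul_norm_sub_apply_le i
    · simpa using l1Norm_nonneg xs
  calc ‖ys‖ ≤ √s * (l1Norm xs / s) :=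
        norm_le_sqrt_mul (div_nonneg (l1Norm_nonneg _) hs0.le) hy.card_supp_le hentry
    _ = l1Norm xs / √s := by
      rw [mul_div_left_comm, Real.sqrt_div_self', mul_one_div]

theorem IsLargestPart.norm_le_specNormCols_mul (A : Matrix (Fin m) (Fin d) ℂ) (hs : 1 ≤ s)
    {xs : EuclideanSpace ℂ (Fin d)} (h : IsLargestPart s x xs) :
    ‖toEuclideanLin A x‖ ≤ specNormCols A s * (‖xs‖ + l1Norm x / √s) := by
  induction hn : (supp x).card using Nat.strong_induction_on generalizing x xs with
  | _ n ih =>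
  subst hn
  have hK := specNormCols_nonneg A s
  rcases eq_or_ne x 0 with rfl | hx
  · rw [map_zero, norm_zero]
    have := l1Norm_nonneg (0 : EuclideanSpace ℂ (Fin d))
    positivity
  obtain ⟨ys, hys⟩ := exists_isLargestPart s (x - xs)
  calc ‖toEuclideanLin A x‖ = ‖toEuclideanLin A xs + toEuclideanLin A (x - xs)‖ := by
        rw [← map_add, add_sub_cancel]
    _ ≤ specNormCols A s * ‖xs‖ + specNormCols A s * (‖ys‖ + l1Norm (x - xs) / √s) :=
      norm_add_le_of_le (norm_le_specNormCols A h.card_supp_le)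
        (ih _ (h.card_supp_sub_lt hs hx) hys rfl)
    _ ≤ specNormCols A s * ‖xs‖ +
        specNormCols A s * (l1Norm xs / √s + l1Norm (x - xs) / √s) := by
      gcongr
      exact h.norm_isLargestPart_sub_le hs hys
    _ = specNormCols A s * (‖xs‖ + l1Norm x / √s) := by
      rw [← h.l1Norm_add_l1Norm_sub]
      ring

theorem norm_le_specNormCols_mul_norm_add (A : Matrix (Fin m) (Fin d) ℂ) (hs : 1 ≤ s)
    (x : EuclideanSpace ℂ (Fin d)) :
    ‖toEuclideanLin A x‖ ≤ specNormCols A s * (‖x‖ + 1 / √s * l1Norm x) := by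
  obtain ⟨xs, h⟩ := exists_isLargestPart s x
  have hxs : ‖xs‖ ≤ ‖x‖ := by
    rw [h.eq_restr]
    exact norm_restr_le _ _
  rw [one_div_mul_eq_div]
  exact (h.norm_le_specNormCols_mul A hs).trans <|
    mul_le_mul_of_nonneg_left (add_le_add_left hxs _) (specNormCols_nonneg A s)

end SpectralNorm

section RIP

variable {m d s : ℕ} {A : Matrix (Fin m) (Fin d) ℂ} {δ : ℝ} {x y : EuclideanSpace ℂ (Fin d)}

theorem exists_rip (A : Matrix (Fin m) (Fin d) ℂ) (s : ℕ) : ∃ δ, 0 ≤ δ ∧ RIP A s δ := by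
  refine ⟨1 + specNormCols A s ^ 2, by positivity, fun x hx => ?_⟩
  have hA := pow_le_pow_left₀ (norm_nonneg _) (norm_le_specNormCols A hx) 2
  rw [mul_pow] at hA
  constructor <;> nlinarith [sq_nonneg ‖x‖, sq_nonneg ‖toEuclideanLin A x‖,
    mul_nonneg (sq_nonneg (specNormCols A s)) (sq_nonneg ‖x‖)]

theorem isClosed_setOf_rip (A : Matrix (Fin m) (Fin d) ℂ) (s : ℕ) :
    IsClosed {δ | 0 ≤ δ ∧ RIP A s δ} := by
  simp only [RIP, Set.ofPred_and, Set.ofPred_forall]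
  exact isClosed_Ici.inter <| isClosed_iInter fun x => isClosed_iInter fun _ =>
    (isClosed_le (by fun_prop) (by fun_prop)).inter (isClosed_le (by fun_prop) (by fun_prop))

theorem ric_mem (A : Matrix (Fin m) (Fin d) ℂ) (s : ℕ) : 0 ≤ ric A s ∧ RIP A s (ric A s) :=
  (isClosed_setOf_rip A s).csInf_mem (exists_rip A s) ⟨0, fun _ h => h.1⟩

theorem ric_nonneg (A : Matrix (Fin m) (Fin d) ℂ) (s : ℕ) : 0 ≤ ric A s :=
  (ric_mem A s).1

theorem rip_ric (A : Matrix (Fin m) (Fin d) ℂ) (s : ℕ) : RIP A s (ric A s) :=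
  (ric_mem A s).2

theorem RIP.mono {t : ℕ} {δ' : ℝ} (h : RIP A t δ) (hst : s ≤ t) (hδ : δ ≤ δ') : RIP A s δ' :=
  fun x hx => ⟨le_trans (by gcongr) (h x (hx.trans hst)).1,
    (h x (hx.trans hst)).2.trans (by gcongr)⟩

theorem RIP.norm_le (h : RIP A s δ) (hx : (supp x).card ≤ s) :
    ‖toEuclideanLin A x‖ ≤ √(1 + δ) * ‖x‖ := by
  have := Real.sqrt_le_sqrt (h x hx).2
  rwa [Real.sqrt_sq (norm_nonneg _), Real.sqrt_mul' _ (sq_nonneg _),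
    Real.sqrt_sq (norm_nonneg _)] at this

theorem RIP.le_norm (h : RIP A s δ) (hx : (supp x).card ≤ s) :
    √(1 - δ) * ‖x‖ ≤ ‖toEuclideanLin A x‖ := by
  have := Real.sqrt_le_sqrt (h x hx).1
  rwa [Real.sqrt_sq (norm_nonneg _), Real.sqrt_mul' _ (sq_nonneg _),
    Real.sqrt_sq (norm_nonneg _)] at this

theorem RIP.specNormCols_le (h : RIP A s δ) : specNormCols A s ≤ √(1 + δ) :=
  MixedCoSaMP.specNormCols_le (Real.sqrt_nonneg _) fun _ hx => h.norm_le hx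

theorem RIP.re_inner_sub_le_sq (h : RIP A s δ) (hxy : (supp x ∪ supp y).card ≤ s) :
    RCLike.re (inner ℂ (toEuclideanLin A x) (toEuclideanLin A y)) - RCLike.re (inner ℂ x y) ≤
      δ / 2 * (‖x‖ ^ 2 + ‖y‖ ^ 2) := by
  have hadd := (h (x + y) ((Finset.card_le_card (supp_add_subset x y)).trans hxy)).2
  have hsub := (h (x - y) ((Finset.card_le_card (supp_sub_subset x y)).trans hxy)).1
  rw [map_add, norm_add_sq (𝕜 := ℂ), norm_add_sq (𝕜 := ℂ)] at hadd
  rw [map_sub, norm_sub_sq (𝕜 := ℂ), norm_sub_sq (𝕜 := ℂ)] at hsub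
  linarith

theorem RIP.re_inner_sub_le (h : RIP A s δ) (hxy : (supp x ∪ supp y).card ≤ s) :
    RCLike.re (inner ℂ (toEuclideanLin A x) (toEuclideanLin A y)) - RCLike.re (inner ℂ x y) ≤
      δ * (‖x‖ * ‖y‖) := by
  rcases eq_or_ne x 0 with rfl | hx
  · simp
  rcases eq_or_ne y 0 with rfl | hy
  · simp
  have hx' : 0 < ‖x‖ := norm_pos_iff.2 hx
  have hy' : 0 < ‖y‖ := norm_pos_iff.2 hy
  -- Rescaling both vectors to the same norm turns the arithmetic mean into the geometric one.
  have hscaled := h.re_inner_sub_le_sq (x := (‖y‖ : ℂ) • x) (y := (‖x‖ : ℂ) • y) <|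
    (Finset.card_le_card
      (Finset.union_subset_union (supp_smul_subset _ _) (supp_smul_subset _ _))).trans hxy
  rw [map_smul, map_smul, inner_smul_left, inner_smul_right, inner_smul_left, inner_smul_right,
    norm_smul, norm_smul] at hscaled
  simp only [Complex.conj_ofReal, RCLike.re_eq_complex_re, Complex.re_ofReal_mul,
    Complex.norm_real, norm_norm] at hscaled ⊢
  refine le_of_mul_le_mul_left ?_ (mul_pos hx' hy')
  linarith

end RIP

section Perturbation

variable {m d s t : ℕ} {A Φ : Matrix (Fin m) (Fin d) ℂ} {δ : ℝ}

theorem relPert_nonneg (A Φ : Matrix (Fin m) (Fin d) ℂ) (t : ℕ) : 0 ≤ relPert A Φ t :=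
  div_nonneg (specNormCols_nonneg _ _) (specNormCols_nonneg _ _)

theorem RIP.of_specNormCols_sub (hA : RIP A t δ) (hδ : -1 ≤ δ)
    (Φ : Matrix (Fin m) (Fin d) ℂ) :
    RIP Φ t ((√(1 + δ) + specNormCols (A - Φ) t) ^ 2 - 1) := by
  intro x hx
  have hp := Real.sqrt_nonneg (1 + δ)
  have hp2 : √(1 + δ) ^ 2 = 1 + δ := Real.sq_sqrt (by linarith)
  have hP := specNormCols_nonneg (A - Φ) t
  have hAx := hA.norm_le hx
  have hAx' := (hA x hx).1
  have hdiff := norm_le_specNormCols (A - Φ) hx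
  rw [map_sub, LinearMap.sub_apply] at hdiff
  have hlt := norm_sub_norm_le (toEuclideanLin A x) (toEuclideanLin Φ x)
  have hgt := norm_sub_norm_le (toEuclideanLin Φ x) (toEuclideanLin A x)
  rw [norm_sub_rev] at hgt
  set p := √(1 + δ)
  set P := specNormCols (A - Φ) t
  have hPx : 0 ≤ P * ‖x‖ := by positivity
  have hΦx : ‖toEuclideanLin Φ x‖ ≤ (p + P) * ‖x‖ := by linarith
  have hsq : ‖toEuclideanLin A x‖ ^ 2 - ‖toEuclideanLin Φ x‖ ^ 2 ≤ P * ‖x‖ * (2 * (p * ‖x‖)) := by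
    rcases le_total ‖toEuclideanLin A x‖ ‖toEuclideanLin Φ x‖ with hle | hle
    · have := pow_le_pow_left₀ (norm_nonneg _) hle 2
      have : 0 ≤ P * ‖x‖ * (2 * (p * ‖x‖)) := by positivity
      linarith
    · rw [sq_sub_sq, mul_comm]
      exact mul_le_mul (by linarith) (by linarith) (by positivity) hPx
  constructor
  · nlinarith [sq_nonneg (P * ‖x‖)]
  · calc ‖toEuclideanLin Φ x‖ ^ 2 ≤ ((p + P) * ‖x‖) ^ 2 := by gcongr
      _ = _ := by ring

theorem RIP.specNormCols_sub_le (hA : RIP A t δ) (hδ : δ < 1) (Φ : Matrix (Fin m) (Fin d) ℂ) :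
    specNormCols (A - Φ) t ≤ relPert A Φ t * √(1 + δ) := by
  have hε := relPert_nonneg A Φ t
  by_cases hK : specNormCols A t = 0
  · refine MixedCoSaMP.specNormCols_le (by positivity) fun x hx => ?_
    have hAx := norm_le_specNormCols A hx
    rw [hK, zero_mul] at hAx
    have hq : 0 < √(1 - δ) := Real.sqrt_pos.2 (sub_pos.2 hδ)
    have hx0 : x = 0 :=
      norm_le_zero_iff.1 (nonpos_of_mul_nonpos_right ((hA.le_norm hx).trans hAx) hq)
    simp [hx0]
  · calc specNormCols (A - Φ) t = relPert A Φ t * specNormCols A t := by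
          rw [relPert, div_mul_cancel₀ _ hK]
      _ ≤ relPert A Φ t * √(1 + δ) := mul_le_mul_of_nonneg_left hA.specNormCols_le hε

theorem RIP.of_relPert (hA : RIP A t δ) (hδ : -1 ≤ δ) (hδ1 : δ < 1)
    (Φ : Matrix (Fin m) (Fin d) ℂ) : RIP Φ t ((1 + relPert A Φ t) ^ 2 * (1 + δ) - 1) := by
  refine (hA.of_specNormCols_sub hδ Φ).mono le_rfl (sub_le_sub_right ?_ 1)
  have hP := specNormCols_nonneg (A - Φ) t
  calc (√(1 + δ) + specNormCols (A - Φ) t) ^ 2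
      ≤ (√(1 + δ) + relPert A Φ t * √(1 + δ)) ^ 2 := by
        gcongr
        exact hA.specNormCols_sub_le hδ1 Φ
    _ = (1 + relPert A Φ t) ^ 2 * √(1 + δ) ^ 2 := by ring
    _ = (1 + relPert A Φ t) ^ 2 * (1 + δ) := by rw [Real.sq_sqrt (by linarith)]

theorem sq_one_add_relPert_mul_le {c : ℝ} (h : ric A t ≤ c / (1 + relPert A Φ t) ^ 2 - 1) :
    (1 + relPert A Φ t) ^ 2 * (1 + ric A t) ≤ c := by
  have hε := relPert_nonneg A Φ t
  rw [← le_div_iff₀' (by positivity)]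
  linarith

theorem one_add_ric_le {c : ℝ} (h : ric A t ≤ c / (1 + relPert A Φ t) ^ 2 - 1) :
    1 + ric A t ≤ c :=
  (le_mul_of_one_le_left (by linarith [ric_nonneg A t])
    (one_le_pow₀ (le_add_of_nonneg_right (relPert_nonneg A Φ t)))).trans
    (sq_one_add_relPert_mul_le h)

theorem rip_of_ric_le {c : ℝ} (hc : c < 2) (h : ric A t ≤ c / (1 + relPert A Φ t) ^ 2 - 1) :
    RIP Φ t (c - 1) :=
  ((rip_ric A t).of_relPert (by linarith [ric_nonneg A t]) (by linarith [one_add_ric_le h])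
    Φ).mono le_rfl (sub_le_sub_right (sq_one_add_relPert_mul_le h) 1)

theorem specNormCols_add_specNormCols_sub_le {c : ℝ} (hc : c < 2)
    (h : ric A t ≤ c / (1 + relPert A Φ t) ^ 2 - 1) :
    specNormCols A t + specNormCols (A - Φ) t ≤ √c := by
  have hε := relPert_nonneg A Φ t
  calc specNormCols A t + specNormCols (A - Φ) t
      ≤ √(1 + ric A t) + relPert A Φ t * √(1 + ric A t) :=
        add_le_add (rip_ric A t).specNormCols_le
          ((rip_ric A t).specNormCols_sub_le (by linarith [one_add_ric_le h]) Φ)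
    _ = √((1 + relPert A Φ t) ^ 2 * (1 + ric A t)) := by
      rw [Real.sqrt_mul (sq_nonneg _), Real.sqrt_sq (by positivity)]
      ring
    _ ≤ √c := Real.sqrt_le_sqrt (sq_one_add_relPert_mul_le h)

theorem norm_toEuclideanLin_add_sub_le (A Φ : Matrix (Fin m) (Fin d) ℂ) (hs : 1 ≤ s)
    (x : EuclideanSpace ℂ (Fin d)) {z : EuclideanSpace ℂ (Fin d)} (hz : (supp z).card ≤ s)
    (e : EuclideanSpace ℂ (Fin m)) :
    ‖toEuclideanLin A x + e - toEuclideanLin Φ z‖ ≤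
      specNormCols A s * (‖x - z‖ + 1 / √s * l1Norm (x - z)) +
        specNormCols (A - Φ) s * ‖z‖ + ‖e‖ :=
  calc ‖toEuclideanLin A x + e - toEuclideanLin Φ z‖
      = ‖toEuclideanLin A (x - z) + toEuclideanLin (A - Φ) z + e‖ := by
        rw [map_sub (toEuclideanLin A), map_sub toEuclideanLin, LinearMap.sub_apply]
        congr 1
        abel
    _ ≤ _ := norm_add₃_le.trans <| add_le_add_left
      (add_le_add (norm_le_specNormCols_mul_norm_add A hs _) (norm_le_specNormCols _ hz)) _

theorem RIP.sqrt_mul_norm_le (hA : RIP A s δ) (hs : 1 ≤ s) (x : EuclideanSpace ℂ (Fin d))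
    {z : EuclideanSpace ℂ (Fin d)} (hz : (supp z).card ≤ s) :
    √(1 - δ) * ‖z‖ ≤
      ‖toEuclideanLin A x‖ + specNormCols A s * (‖x - z‖ + 1 / √s * l1Norm (x - z)) :=
  calc √(1 - δ) * ‖z‖ ≤ ‖toEuclideanLin A z‖ := hA.le_norm hz
    _ = ‖toEuclideanLin A x - toEuclideanLin A (x - z)‖ := by rw [← map_sub, sub_sub_cancel]
    _ ≤ ‖toEuclideanLin A x‖ + ‖toEuclideanLin A (x - z)‖ := norm_sub_le _ _
    _ ≤ _ := by
      gcongr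
      exact norm_le_specNormCols_mul_norm_add A hs _

theorem RIP.norm_toEuclideanLin_add_sub_le_of_add_le (hA : RIP A s 0.1) (hs : 1 ≤ s)
    (x : EuclideanSpace ℂ (Fin d)) {z : EuclideanSpace ℂ (Fin d)} (hz : (supp z).card ≤ s)
    (e : EuclideanSpace ℂ (Fin m)) (hKP : specNormCols A s + specNormCols (A - Φ) s ≤ 1.05) :
    ‖toEuclideanLin A x + e - toEuclideanLin Φ z‖ ≤
      1.4 * (‖x - z‖ + 1 / √s * l1Norm (x - z)) +
        10 / 9 * (specNormCols (A - Φ) s * ‖toEuclideanLin A x‖) + ‖e‖ := by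
  have hnoise := norm_toEuclideanLin_add_sub_le A Φ hs x hz e
  have hz' := hA.sqrt_mul_norm_le hs x hz
  have hK := specNormCols_nonneg A s
  have hP := specNormCols_nonneg (A - Φ) s
  have hE : 0 ≤ ‖x - z‖ + 1 / √s * l1Norm (x - z) := by
    have := l1Norm_nonneg (x - z)
    positivity
  have hq : 0.9 ≤ √(1 - 0.1 : ℝ) := Real.le_sqrt_of_sq_le (by norm_num)
  set E := ‖x - z‖ + 1 / √s * l1Norm (x - z)
  set K := specNormCols A s
  set P := specNormCols (A - Φ) s
  have hznorm : 0.9 * ‖z‖ ≤ ‖toEuclideanLin A x‖ + K * E := le_trans (by gcongr) hz'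
  have hcoef : K + 10 / 9 * (P * K) ≤ 1.4 := by nlinarith [sq_nonneg (K - P)]
  calc ‖toEuclideanLin A x + e - toEuclideanLin Φ z‖ ≤ K * E + P * ‖z‖ + ‖e‖ := hnoise
    _ ≤ K * E + P * (10 / 9 * (‖toEuclideanLin A x‖ + K * E)) + ‖e‖ := by
      linarith [mul_le_mul_of_nonneg_left hznorm hP]
    _ = (K + 10 / 9 * (P * K)) * E + 10 / 9 * (P * ‖toEuclideanLin A x‖) + ‖e‖ := by ring
    _ ≤ _ := by gcongr

end Perturbation

section Proxy

variable {m d s k : ℕ} {Φ : Matrix (Fin m) (Fin d) ℂ} {δ : ℝ} {T : Finset (Fin d)}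

theorem inner_toEuclideanLin_left (A : Matrix (Fin m) (Fin d) ℂ) (x : EuclideanSpace ℂ (Fin d))
    (y : EuclideanSpace ℂ (Fin m)) :
    inner ℂ (toEuclideanLin A x) y = inner ℂ x (toEuclideanLin Aᴴ y) := by
  rw [Matrix.toEuclideanLin_conjTranspose_eq_adjoint, LinearMap.adjoint_inner_right]

theorem RIP.norm_restr_proxy_sub_le (hΦ : RIP Φ s δ) (hδ : 0 ≤ δ)
    {r : EuclideanSpace ℂ (Fin d)} (hT : (T ∪ supp r).card ≤ s) (v : EuclideanSpace ℂ (Fin m)) :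
    ‖restr T (toEuclideanLin Φᴴ v - r)‖ ≤ δ * ‖r‖ + √(1 + δ) * ‖v - toEuclideanLin Φ r‖ := by
  set z := restr T (toEuclideanLin Φᴴ v - r) with hz
  have hzT : supp z ⊆ T := supp_restr_subset _ _
  have hΦz := hΦ.norm_le
    ((Finset.card_le_card (hzT.trans Finset.subset_union_left)).trans hT)
  have hsq : ‖z‖ * ‖z‖ ≤ (δ * ‖r‖ + √(1 + δ) * ‖v - toEuclideanLin Φ r‖) * ‖z‖ :=
    calc ‖z‖ * ‖z‖ = RCLike.re (inner ℂ z (toEuclideanLin Φᴴ v - r)) := by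
          rw [← sq, hz, norm_sq_restr_eq_re_inner]
      _ = (RCLike.re (inner ℂ (toEuclideanLin Φ z) (toEuclideanLin Φ r)) -
            RCLike.re (inner ℂ z r)) +
          RCLike.re (inner ℂ (toEuclideanLin Φ z) (v - toEuclideanLin Φ r)) := by
        simp only [inner_sub_right, map_sub, inner_toEuclideanLin_left]
        ring
      _ ≤ δ * (‖z‖ * ‖r‖) + ‖toEuclideanLin Φ z‖ * ‖v - toEuclideanLin Φ r‖ :=
        add_le_add (hΦ.re_inner_sub_le
          ((Finset.card_le_card (Finset.union_subset_union_left hzT)).trans hT))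
          (re_inner_le_norm _ _)
      _ ≤ δ * (‖z‖ * ‖r‖) + √(1 + δ) * ‖z‖ * ‖v - toEuclideanLin Φ r‖ := by gcongr
      _ = _ := by ring
  rcases (norm_nonneg z).eq_or_lt with h0 | hpos
  · rw [← h0]
    positivity
  · exact le_of_mul_le_mul_right hsq hpos

theorem RIP.norm_restr_compl_le_of_isLargestPart (hΦ : RIP Φ s δ) (hδ : 0 ≤ δ)
    (hk : k + k ≤ s) {r u : EuclideanSpace ℂ (Fin d)} (hr : (supp r).card ≤ k)
    {v : EuclideanSpace ℂ (Fin m)} (hu : IsLargestPart k (toEuclideanLin Φᴴ v) u) :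
    ‖restr (supp u)ᶜ r‖ ≤ 2 * (δ * ‖r‖ + √(1 + δ) * ‖v - toEuclideanLin Φ r‖) := by
  set p := toEuclideanLin Φᴴ v
  have hcard : (supp u ∪ supp r).card ≤ s :=
    (Finset.card_union_le _ _).trans ((add_le_add hu.card_supp_le hr).trans hk)
  have hproxy {T : Finset (Fin d)} (hT : T ⊆ supp u ∪ supp r) :
      ‖restr T (p - r)‖ ≤ δ * ‖r‖ + √(1 + δ) * ‖v - toEuclideanLin Φ r‖ :=
    hΦ.norm_restr_proxy_sub_le hδ
      ((Finset.card_le_card (Finset.union_subset hT Finset.subset_union_right)).trans hcard) v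
  have hmissed :=
    hproxy (T := supp r \ supp u) (Finset.sdiff_subset.trans Finset.subset_union_right)
  have hspurious :=
    hproxy (T := supp u \ supp r) (Finset.sdiff_subset.trans Finset.subset_union_left)
  have hr0 : restr (supp u \ supp r) p = restr (supp u \ supp r) (p - r) :=
    restr_congr fun i hi => by simp [notMem_supp.1 (Finset.mem_sdiff.1 hi).2]
  calc ‖restr (supp u)ᶜ r‖ = ‖restr (supp r \ supp u) p - restr (supp r \ supp u) (p - r)‖ := by
        rw [restr_compl_eq_restr_supp_sdiff, ← map_sub, sub_sub_cancel]
    _ ≤ ‖restr (supp r \ supp u) p‖ + ‖restr (supp r \ supp u) (p - r)‖ := norm_sub_le _ _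
    _ ≤ ‖restr (supp u \ supp r) p‖ + ‖restr (supp r \ supp u) (p - r)‖ := by
      gcongr
      exact hu.norm_restr_sdiff_le hr
    _ ≤ _ := by
      rw [hr0]
      linarith

end Proxy

section LeastSquares

variable {m d s : ℕ} {Φ : Matrix (Fin m) (Fin d) ℂ} {δ : ℝ} {T : Finset (Fin d)}
  {x w : EuclideanSpace ℂ (Fin d)} {y : EuclideanSpace ℂ (Fin m)}

theorem IsPinv.conjTranspose_mul {m n : Type*} [Fintype m] [Fintype n] {M : Matrix m n ℂ}
    {B : Matrix n m ℂ} (h : IsPinv M B) : Mᴴ * (M * B) = Mᴴ := by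
  rw [← h.left_herm, ← Matrix.conjTranspose_mul, h.mul_mul_self]

theorem IsEstimate.restr_conjTranspose_residual (h : IsEstimate Φ y T w) :
    restr T (toEuclideanLin Φᴴ (y - toEuclideanLin Φ w)) = 0 := by
  have hw : (fun i : {i // i ∈ T} => w i.1) = pinv (cols Φ T) *ᵥ y.ofLp := funext h.1
  have hΦw : (toEuclideanLin Φ w).ofLp = cols Φ T *ᵥ (pinv (cols Φ T) *ᵥ y.ofLp) := by
    rw [← hw]
    exact mulVec_eq_cols_mulVec Φ h.2
  have hnormal : (cols Φ T)ᴴ *ᵥ (y.ofLp - (toEuclideanLin Φ w).ofLp) = 0 := by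
    rw [hΦw, Matrix.mulVec_sub, Matrix.mulVec_mulVec, Matrix.mulVec_mulVec,
      Matrix.mul_assoc, (isPinv_pinv _).conjTranspose_mul, sub_self]
  ext i
  rw [restr_apply]
  split_ifs with hi
  · exact congrFun hnormal ⟨i, hi⟩
  · rfl

theorem IsEstimate.norm_sub_le (h : IsEstimate Φ y T w) (hΦ : RIP Φ s δ) (hδ : 0 ≤ δ)
    (hT : (T ∪ supp x).card ≤ s) :
    (1 - δ) * ‖x - w‖ ≤ ‖restr Tᶜ x‖ + √(1 + δ) * ‖y - toEuclideanLin Φ x‖ := by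
  have hsupp : supp (x - w) ⊆ T ∪ supp x := by
    rw [Finset.union_comm]
    exact (supp_sub_subset x w).trans
      (Finset.union_subset_union_right (supp_subset_iff.2 h.2))
  have hon : ‖restr T (x - w)‖ ≤ δ * ‖x - w‖ + √(1 + δ) * ‖y - toEuclideanLin Φ x‖ := by
    have hproxy := hΦ.norm_restr_proxy_sub_le hδ (r := x - w)
      ((Finset.card_le_card (Finset.union_subset Finset.subset_union_left hsupp)).trans hT)
      (y - toEuclideanLin Φ w)
    rwa [map_sub (restr T), h.restr_conjTranspose_residual, zero_sub, norm_neg,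
      map_sub (toEuclideanLin Φ), sub_sub_sub_cancel_right] at hproxy
  have hoff : restr Tᶜ (x - w) = restr Tᶜ x :=
    restr_congr fun i hi => by simp [h.2 i (Finset.mem_compl.1 hi)]
  have htri := norm_add_le (restr T (x - w)) (restr Tᶜ (x - w))
  rw [restr_add_restr_compl, hoff] at htri
  linarith

end LeastSquares

section Iteration

variable {m d s : ℕ} {Φ : Matrix (Fin m) (Fin d) ℂ} {δ : ℝ}
  {x : EuclideanSpace ℂ (Fin d)} {y : EuclideanSpace ℂ (Fin m)}

theorem IsStep.exists_bounds {a a' : EuclideanSpace ℂ (Fin d)} (h : IsStep Φ y s a a')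
    (hΦ : RIP Φ (4 * s) δ) (hδ : 0 ≤ δ) (hδ1 : δ ≤ 1) (hx : (supp x).card ≤ s)
    (ha : (supp a).card ≤ s) :
    ∃ T : Finset (Fin d),
      ‖restr Tᶜ x‖ ≤ 2 * (δ * ‖x - a‖ + √(1 + δ) * ‖y - toEuclideanLin Φ x‖) ∧
      (1 - δ) * ‖x - a'‖ ≤ 2 * (‖restr Tᶜ x‖ + √(1 + δ) * ‖y - toEuclideanLin Φ x‖) := by
  obtain ⟨v, u, u', w, rfl, rfl, hu, hw, ha'⟩ := h
  refine ⟨supp u' ∪ supp a, ?_, ?_⟩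
  · have hident := hΦ.norm_restr_compl_le_of_isLargestPart hδ (r := x - a) (by omega)
      ((card_supp_sub_le x a).trans (by omega)) hu
    rw [map_sub (toEuclideanLin Φ), sub_sub_sub_cancel_right] at hident
    calc ‖restr (supp u' ∪ supp a)ᶜ x‖ = ‖restr (supp u' ∪ supp a)ᶜ (x - a)‖ := by
          refine congrArg norm (restr_congr fun i hi => ?_)
          simp only [Finset.mem_compl, Finset.mem_union, not_or, notMem_supp] at hi
          simp [hi.2]
      _ ≤ ‖restr (supp u')ᶜ (x - a)‖ :=
        norm_restr_mono (Finset.compl_subset_compl.2 Finset.subset_union_left) _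
      _ ≤ _ := hident
  · have hcard : (supp u' ∪ supp a ∪ supp x).card ≤ 4 * s := by
      have := hu.card_supp_le
      have := Finset.card_union_le (supp u' ∪ supp a) (supp x)
      have := Finset.card_union_le (supp u') (supp a)
      omega
    have hprune : ‖x - a'‖ ≤ 2 * ‖x - w‖ :=
      calc ‖x - a'‖ ≤ ‖x - w‖ + ‖w - a'‖ := norm_sub_le_norm_sub_add_norm_sub x w a'
        _ ≤ ‖x - w‖ + ‖w - x‖ := by
          gcongr
          exact ha'.norm_sub_le hx
        _ = 2 * ‖x - w‖ := by rw [norm_sub_rev w x, two_mul]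
    calc (1 - δ) * ‖x - a'‖ ≤ (1 - δ) * (2 * ‖x - w‖) :=
          mul_le_mul_of_nonneg_left hprune (sub_nonneg.2 hδ1)
      _ = 2 * ((1 - δ) * ‖x - w‖) := by ring
      _ ≤ _ := mul_le_mul_of_nonneg_left (hw.norm_sub_le hΦ hδ hcard) zero_le_two

theorem IsRun.card_supp_le {a : ℕ → EuclideanSpace ℂ (Fin d)} (h : IsRun Φ y s a) (k : ℕ) :
    (supp (a k)).card ≤ s := by
  cases k with
  | zero => simp [h.1, supp]
  | succ k =>
    obtain ⟨_, _, _, _, -, -, -, -, ha⟩ := h.2 k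
    exact ha.card_supp_le

theorem norm_restr_compl_le_of_forall_succ_lt {c : ℝ} {T : ℕ → Finset (Fin d)}
    (hx : (supp x).card ≤ s) (hle : ∀ k, ‖restr (T k)ᶜ x‖ ≤ c → ‖restr (T (k + 1))ᶜ x‖ ≤ c)
    (hlt : ∀ k, c < ‖restr (T k)ᶜ x‖ → ‖restr (T (k + 1))ᶜ x‖ < ‖restr (T k)ᶜ x‖)
    {k : ℕ} (hk : 2 ^ s ≤ k) : ‖restr (T k)ᶜ x‖ ≤ c := by
  refine le_of_forall_succ_lt_of_card_le (u := fun k => ‖restr (T k)ᶜ x‖) hle hlt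
    (F := (supp x).powerset.image fun R => ‖restr R x‖) (fun k => ?_) ?_
  · exact Finset.mem_image.2 ⟨supp x \ T k, Finset.mem_powerset.2 Finset.sdiff_subset,
      by rw [restr_compl_eq_restr_supp_sdiff]⟩
  · calc ((supp x).powerset.image fun R => ‖restr R x‖).card ≤ (supp x).powerset.card :=
          Finset.card_image_le
      _ = 2 ^ (supp x).card := Finset.card_powerset _
      _ ≤ 2 ^ s := Nat.pow_le_pow_right two_pos hx
      _ ≤ k := hk

theorem IsRun.norm_sub_le {a : ℕ → EuclideanSpace ℂ (Fin d)} (h : IsRun Φ y s a)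
    (hΦ : RIP Φ (4 * s) δ) (hδ0 : 0 ≤ δ) (hδ : δ < 1 / 5) (hx : (supp x).card ≤ s)
    {k : ℕ} (hk : 2 ^ s + 1 ≤ k) :
    ‖x - a k‖ ≤ 6 * √(1 + δ) / (1 - 5 * δ) * ‖y - toEuclideanLin Φ x‖ := by
  choose T hmissed herror using fun k =>
    (h.2 k).exists_bounds hΦ hδ0 (by linarith) hx (h.card_supp_le k)
  set σ := √(1 + δ) * ‖y - toEuclideanLin Φ x‖ with hσ
  have h5 : 0 < 1 - 5 * δ := by linarith
  obtain ⟨c, hc⟩ : ∃ c, (1 - 5 * δ) * c = (2 + 2 * δ) * σ := ⟨_, mul_div_cancel₀ _ h5.ne'⟩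
  have hrec (j : ℕ) : (1 - δ) * ‖restr (T (j + 1))ᶜ x‖ ≤
      4 * δ * ‖restr (T j)ᶜ x‖ + (1 - 5 * δ) * c := by
    nlinarith [hmissed (j + 1), herror j]
  obtain ⟨j, rfl⟩ := Nat.exists_eq_add_of_le' (Nat.one_le_of_lt hk)
  have hTj : ‖restr (T j)ᶜ x‖ ≤ c :=
    norm_restr_compl_le_of_forall_succ_lt hx
      (fun i hi => by nlinarith [hrec i]) (fun i hi => by nlinarith [hrec i]) (by omega)
  refine le_of_mul_le_mul_left (a := 1 - δ) ?_ (by linarith)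
  calc (1 - δ) * ‖x - a (j + 1)‖ ≤ 2 * (c + σ) := (herror j).trans (by gcongr)
    _ = (1 - δ) * (6 * σ / (1 - 5 * δ)) := by
      rw [mul_div_assoc', eq_div_iff h5.ne']
      linear_combination 2 * hc
    _ = _ := by rw [hσ]; ring

end Iteration

end MixedCoSaMP

open MixedCoSaMP Matrix in
theorem theorem2p2_general {m d s : ℕ} (hs : 1 ≤ s) {A Φ : Matrix (Fin m) (Fin d) ℂ}
    {x z : EuclideanSpace ℂ (Fin d)} {e : EuclideanSpace ℂ (Fin m)}
    (hA : ric A (4 * s) ≤ 1.1 / (1 + relPert A Φ (4 * s)) ^ 2 - 1) (hz : (supp z).card ≤ s)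
    {a : ℕ → EuclideanSpace ℂ (Fin d)} (ha : IsRun Φ (toEuclideanLin A x + e) s a)
    {k : ℕ} (hk : 2 ^ s + 1 ≤ k) :
    ‖a k - x‖ ≤ 20 * (‖x - z‖ + 1 / √(s : ℝ) * l1Norm (x - z)
      + specNormCols (A - Φ) s * ‖toEuclideanLin A x‖ + ‖e‖) := by
  have hΦ : RIP Φ (4 * s) 0.1 := (rip_of_ric_le (by norm_num) hA).mono le_rfl (by norm_num)
  have hA' : RIP A s 0.1 :=
    (rip_ric A (4 * s)).mono (by omega) (by linarith [one_add_ric_le hA])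
  have hKP : specNormCols A s + specNormCols (A - Φ) s ≤ 1.05 :=
    calc specNormCols A s + specNormCols (A - Φ) s
        ≤ specNormCols A (4 * s) + specNormCols (A - Φ) (4 * s) :=
          add_le_add (specNormCols_mono A (by omega)) (specNormCols_mono _ (by omega))
      _ ≤ √1.1 := specNormCols_add_specNormCols_sub_le (by norm_num) hA
      _ ≤ 1.05 := Real.sqrt_le_iff.2 (by norm_num)
  have hrun : ‖z - a k‖ ≤ 12.6 * ‖toEuclideanLin A x + e - toEuclideanLin Φ z‖ := by
    refine (ha.norm_sub_le hΦ (by norm_num) (by norm_num) hz hk).trans ?_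
    gcongr
    have : √(1 + 0.1 : ℝ) ≤ 1.05 := Real.sqrt_le_iff.2 (by norm_num)
    norm_num at this ⊢
    linarith
  have hnoise := hA'.norm_toEuclideanLin_add_sub_le_of_add_le hs x hz e hKP
  have htri := norm_sub_le_norm_sub_add_norm_sub (a k) z x
  have hl1 : 0 ≤ 1 / √(s : ℝ) * l1Norm (x - z) := mul_nonneg (by positivity) (l1Norm_nonneg _)
  have hP : 0 ≤ specNormCols (A - Φ) s * ‖toEuclideanLin A x‖ :=
    mul_nonneg (specNormCols_nonneg _ _) (norm_nonneg _)
  rw [norm_sub_rev z x, norm_sub_rev (a k) z] at htri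
  linarith [norm_nonneg e, norm_nonneg (x - z)]

open MixedCoSaMP in
theorem theorem2p2 :
    ∃ C : ℝ, 0 < C ∧ ∃ N : ℕ → ℕ,
      ∀ (m d s : ℕ), 1 ≤ s →
      ∀ (A Φ : Matrix (Fin m) (Fin d) ℂ)
        (x xs : EuclideanSpace ℂ (Fin d)) (b e y : EuclideanSpace ℂ (Fin m)),
        ric A (4 * s) ≤ 1.1 / (1 + relPert A Φ (4 * s)) ^ 2 - 1 →
        IsLargestPart s x xs →
        alpha x xs + beta s x xs ≤ 1 / (2 * kappa A s) →
        b = Matrix.toEuclideanLin A x →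
        y = b + e →
        ∀ a : ℕ → EuclideanSpace ℂ (Fin d), IsRun Φ y s a →
          ∀ k, N s ≤ k →
            ‖a k - x‖ ≤ C * (‖x - xs‖ + 1 / √(s : ℝ) * l1Norm (x - xs)
              + (specNorm (A - Φ) * alpha x xs + specNormCols (A - Φ) s) * ‖b‖ + ‖e‖) := by
  refine ⟨20, by norm_num, fun s => 2 ^ s + 1, ?_⟩
  rintro m d s hs A Φ x xs _ e _ hA hxs - rfl rfl a ha k hk
  refine (theorem2p2_general hs hA hxs.card_supp_le ha hk).trans ?_
  have hα : 0 ≤ specNorm (A - Φ) * alpha x xs :=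
    mul_nonneg (specNorm_nonneg _) (div_nonneg (norm_nonneg _) (norm_nonneg _))
  gcongr
  exact le_add_of_nonneg_left hα
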